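/- **Theorem 4.1.** Consider a stochastic shortest path problem with finite state space $\mathcal S$, finite action space $\mathcal A$, start state $s_0\in\mathcal S$, absorbing goal $g\notin\mathcal S$, known transition function $P(\cdot\mid s,a)$ on $\mathcal S\cup\{g\}$, and $K\ge 1$ cost functions $c_1,\dots,c_K:\mathcal S\times\mathcal A\to[0,1]$ fixed in advance. For a stationary policy $\pi$ let $T^\pi(s)$ be the expected number of steps needed to reach $g$ from $s$, let $J_k^\pi$ be the expected total cost, under $c_k$, of an episode following $\pi$ from $s_0$ until $g$ is reached, and let $q_\pi(s,a)$ be the expected number of visits to $(s,a)$ in such an episode. A stationary policy is proper if it reaches $g$ almost surely from every state; $\Pi_p$ is the set of these policies and $D=\min_{\pi\in\Pi_p}\max_{s}T^\pi(s)$ is the diameter. Let $\pi^\star\in\arg\min_{\pi\in\Pi_p}\sum_{k=1}^K J_k^\pi$ and $$\Delta(T)=\Big\{q\in\mathbb R_{\ge 0}^{\mathcal S\times\mathcal A}:\ \sum_{s,a}q(s,a)\le T,\quad \sum_a q(s,a)-\sum_{s',a'}P(s\mid s',a')\,q(s',a')=\mathbb 1\{s=s_0\}\ \ \forall s\in\mathcal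 S\Big\}.$$ Let $M$ be the sparsity level $\max_k|\{(s,a):c_k(s,a)>0\}|$ or, more generally, any upper bound on $\max_k\|c_k\|_1$. Let $T>e$ be such that $q_{\pi^\star}\in\Delta(T)$, put $$p=\log(TM),\qquad \eta=\sqrt{\frac{p\,T^{1+1/p}}{K D M^{1/p}}},\qquad \psi_p(q)=p\Big(-1+\sum_{s,a}|q(s,a)|^{1+1/p}\Big),$$ and assume $p>1$ (which is automatic if $M\ge 1$). Online mirror descent computes $$q_1\in\arg\min_{q\in\Delta(T)}\psi_p(q),\qquad q_{k+1}\in\arg\min_{q\in\Delta(T)}\big\{\eta\langle q,c_k\rangle+D_{\psi_p}(q,q_k)\big\},$$ where $D_{\psi}(x,y)=\psi(x)-\psi(y)-\langle\nabla\psi(y),x-y\rangle$. In episode $k$ the learner follows from $s_0$ a policy $\pi_k$ with $\pi_k(a\mid s)=q_k(s,a)/\sum_{a'}q_k(s,a')$ wherever the denominator is nonzero, and $\pi_k(\cdot\mid s)$ arbitrary elsewhere. The $K$ episodes are independent; $(s_k^t,a_k^t)$ is the $t$-th state-action pair of episode $k$ and $I_k$ is its length. Then, for the regret $$R_K=\sum_{k=1}^K\sum_{t=1}^{I_k}c_k(s_k^t,a_k^t)-\sum_{k=1}^K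 J_k^{\pi^\star},$$ every episode has finite expected length, $R_K$ is integrable, and $$\mathbb E[R_K]\le C\sqrt{D\,K\,T\,\log(MT)},$$ where $C>0$ is a universal constant, independent of all the quantities above. -/

import Mathlib

open MeasureTheory ProbabilityTheory
open scoped ENNReal

noncomputable section

/-- A stochastic shortest path model with non-goal states `S` and actions `A`.
The goal `g` is the point `none` of `Option S`: `P s a` is the law of the next state. -/
structure SSP (S A : Type*) where
  P : S → A → PMF (Option S)
  s₀ : S

namespace SSP

/-- Stationary (randomized) policies. -/
abbrev Policy (S A : Type*) := S → PMF A

/-- What happens at one time step: `some (s, a)` means that the process is in the non-goal state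
`s` and plays `a`; `none` means that the process is in the goal. -/
abbrev Visit (S A : Type*) := Option (S × A)

instance (S A : Type*) : MeasurableSpace (Visit S A) := ⊤

instance (S A : Type*) : DiscreteMeasurableSpace (Visit S A) := ⟨fun _ => trivial⟩

section Dynamics

variable {S A : Type*}

/-- Being in state `s`, draw the action from `π`. -/
def act (π : Policy S A) (s : S) : PMF (Visit S A) := (π s).map fun a => some (s, a)

/-- Being in a state or in the goal, draw the action from `π` (nothing happens in the goal). -/
def enter (π : Policy S A) : Option S → PMF (Visit S A)
  | none => PMF.pure none
  | some s => act π s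

/-- One step of the process under `π`; the goal is absorbing. -/
def step (m : SSP S A) (π : Policy S A) : Visit S A → PMF (Visit S A)
  | none => PMF.pure none
  | some (s, a) => (m.P s a).bind (enter π)

variable [Fintype S] [Fintype A]

/-- The transition kernel of the process under `π`. -/
def stepKernel (m : SSP S A) (π : Policy S A) : Kernel (Visit S A) (Visit S A) :=
  Kernel.ofFunOfCountable fun v => (step m π v).toMeasure

instance (m : SSP S A) (π : Policy S A) : IsMarkovKernel (stepKernel m π) :=
  ⟨fun v => inferInstanceAs (IsProbabilityMeasure (step m π v).toMeasure)⟩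

/-- The step kernel as a function of the whole past, which it uses only through the present. -/
def historyKernel (m : SSP S A) (π : Policy S A) (n : ℕ) :
    Kernel ((i : Finset.Iic n) → Visit S A) (Visit S A) :=
  (stepKernel m π).comap (fun h => h ⟨n, Finset.mem_Iic.2 le_rfl⟩) (measurable_pi_apply _)

instance (m : SSP S A) (π : Policy S A) (n : ℕ) : IsMarkovKernel (historyKernel m π n) := by
  unfold historyKernel; infer_instance

/-- The law of an episode (an infinite trajectory, constantly `none` after reaching the goal)
that starts in state `s` and follows `π`: the law of the Markov chain with the kernel above. -/
def episodeLaw (m : SSP S A) (π : Policy S A) (s : S) : Measure (ℕ → Visit S A) :=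
  Kernel.trajMeasure (X := fun _ => Visit S A) (act π s).toMeasure (historyKernel m π)

instance (m : SSP S A) (π : Policy S A) (s : S) :
    IsProbabilityMeasure (episodeLaw m π s) := by
  unfold episodeLaw; infer_instance

/-- The number of steps after which a trajectory reaches the goal (`∞` if it never does). -/
def hitTime (ω : ℕ → Visit S A) : ℝ≥0∞ := ⨅ (n : ℕ) (_ : ω n = none), (n : ℝ≥0∞)

/-- The expected hitting time `T^π(s)`. -/
def expectedHitTime (m : SSP S A) (π : Policy S A) (s : S) : ℝ≥0∞ :=
  ∫⁻ ω, hitTime ω ∂(episodeLaw m π s)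

/-- `π` is proper: from every state it reaches the goal almost surely. -/
def IsProper (m : SSP S A) (π : Policy S A) : Prop :=
  ∀ s, ∀ᵐ ω ∂(episodeLaw m π s), ∃ n, ω n = none

/-- The diameter: the smallest worst-state expected hitting time of a proper policy. -/
def diameter (m : SSP S A) : ℝ :=
  (⨅ (π : Policy S A) (_ : IsProper m π), ⨆ s, expectedHitTime m π s).toReal

/-- The cost incurred at one time step; nothing is paid in the goal. -/
def visitCost (c : S × A → ℝ) : Visit S A → ℝ≥0∞
  | none => 0
  | some x => ENNReal.ofReal (c x)

/-- The total cost of an episode. -/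
def episodeCost (c : S × A → ℝ) (ω : ℕ → Visit S A) : ℝ≥0∞ := ∑' t, visitCost c (ω t)

/-- The cost-to-go `J^π_c(s)`. -/
def costToGo (m : SSP S A) (c : S × A → ℝ) (π : Policy S A) (s : S) : ℝ≥0∞ :=
  ∫⁻ ω, episodeCost c ω ∂(episodeLaw m π s)

/-- The occupancy measure `q_π`: expected number of visits to a state-action pair
in an episode started in `s₀` (finite for proper `π`). -/
def occupancy (m : SSP S A) (π : Policy S A) : S × A → ℝ := fun x =>
  (∫⁻ ω, ∑' t, Set.indicator {ω' : ℕ → Visit S A | ω' t = some x} 1 ω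
    ∂(episodeLaw m π m.s₀)).toReal

/-- `πs` is a best proper policy in hindsight for the costs `c 0, …, c (K - 1)`. -/
def IsBestInHindsight (m : SSP S A) (c : ℕ → S × A → ℝ) (K : ℕ) (πs : Policy S A) : Prop :=
  IsProper m πs ∧ ∀ π, IsProper m π →
    ∑ k ∈ Finset.range K, costToGo m (c k) πs m.s₀ ≤
      ∑ k ∈ Finset.range K, costToGo m (c k) π m.s₀

/-- The joint law of the `K` independent episodes in which the learner follows `π k` from `s₀`
in episode `k`. -/
def learnerLaw (m : SSP S A) (K : ℕ) (π : ℕ → Policy S A) :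
    Measure (Fin K → ℕ → Visit S A) :=
  Measure.pi fun k : Fin K => episodeLaw m (π k) m.s₀

/-- The (random) regret `R_K` against the policy `πs`, as a function of the `K` trajectories. -/
def regret (m : SSP S A) (c : ℕ → S × A → ℝ) (K : ℕ) (πs : Policy S A)
    (ω : Fin K → ℕ → Visit S A) : ℝ :=
  ∑ k : Fin K, (episodeCost (c k) (ω k)).toReal -
    ∑ k : Fin K, (costToGo m (c k) πs m.s₀).toReal

open Classical in
/-- The polytope `Δ(T)`. -/
def polytope (m : SSP S A) (T : ℝ) : Set (S × A → ℝ) :=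
  {q | (∀ x, 0 ≤ q x) ∧ ∑ x, q x ≤ T ∧
    ∀ s, ∑ a, q (s, a) - ∑ x : S × A, (m.P x.1 x.2 (some s)).toReal * q x =
      if s = m.s₀ then 1 else 0}

/-- The policy `π` is obtained from `q` by normalization, `π(a|s) = q(s,a) / ∑ a', q(s,a')`,
in every state where that makes sense; elsewhere it is arbitrary. -/
def IsInducedPolicy (q : S × A → ℝ) (π : Policy S A) : Prop :=
  ∀ s, ∑ a', q (s, a') ≠ 0 → ∀ a, (π s a).toReal = q (s, a) / ∑ a', q (s, a')

end Dynamics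

section MirrorDescent

variable {Γ : Type*} [Fintype Γ]

/-- The regularizer `ψ_p`. -/
def regularizer (p : ℝ) (q : Γ → ℝ) : ℝ := p * (-1 + ∑ x, |q x| ^ (1 + 1 / p))

/-- The Bregman divergence of `ψ`. -/
def bregman (ψ : (Γ → ℝ) → ℝ) (x y : Γ → ℝ) : ℝ := ψ x - ψ y - fderiv ℝ ψ y (x - y)

/-- `q 0, …, q (K - 1)` are the iterates of online mirror descent over the set `Q` with
regularizer `ψ` and step size `η` on the linear losses `c 0, …, c (K - 1)`. -/
def IsOMD (Q : Set (Γ → ℝ)) (ψ : (Γ → ℝ) → ℝ) (η : ℝ) (c : ℕ → Γ → ℝ) (K : ℕ)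
    (q : ℕ → Γ → ℝ) : Prop :=
  (q 0 ∈ Q ∧ IsMinOn ψ Q (q 0)) ∧
  ∀ k, k + 1 < K → q (k + 1) ∈ Q ∧
    IsMinOn (fun x => η * ∑ i, x i * c k i + bregman ψ x (q k)) Q (q (k + 1))

/-- The sparsity level: the largest number of nonzero costs in an episode. -/
def sparsityLevel (c : ℕ → Γ → ℝ) (K : ℕ) : ℕ :=
  (Finset.range K).sup fun k => {x | 0 < c k x}.ncard

end MirrorDescent

end SSP

end

/-! Everything about episodes is reduced to linear algebra. By absorption, the expected hitting time
equals the total expected number of visits, and a proper policy on finitely many states survives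
with geometrically decaying probability, so these quantities are finite. Expected costs are then
linear in the occupancy measure, which satisfies the flow equations. Conversely, a policy induced by
a point `q` of the polytope visits each pair at most `q x` times (`visits_le_of_mem_polytope`).
Hence the expected regret is at most the regret of mirror descent on linear losses.

For mirror descent, the three-point inequality telescopes. Each step is bounded below by an
unconstrained minimum, coordinate by coordinate, which yields `stepGain` and
`IsOMD.sum_stepGain_le`: the gains sum to at most `η` times the comparator's loss plus `p * T ^ (1 +
1 / p)`.

It remains to compare gain with loss. Put `a = η * M ^ (1 / p)`; the choice of `p` makes `(T * M) ^
(1 / p) = e`, so `a * K * D` is of order `√(D K T p)`. If `a ≤ 1`, a second-order expansion bounds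
the regret by `4 * (a * K * D)`. The expansion costs `q ^ (1 - 1 / p) * c ^ 2`, which is at most `M
^ (1 / p) * (q * c + c / M)`; here sparsity enters. If `a ≥ 1`, the learner's whole loss is bounded.
When `T * K ≤ p * D` the trivial bound `T * K` suffices. Otherwise the mirror descent inequality is
used with a comparator of length at most `min T (2 D)`, because the penalty `p * T` of the best
policy may be too large. -/

noncomputable section

namespace SSP

/-! ### One-time and two-time marginals of an episode -/

section Marginals

variable {S A : Type*}

lemma measurableSet_eval_eq (n : ℕ) (v : Visit S A) :
    MeasurableSet {ω : ℕ → Visit S A | ω n = v} := by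
  have h : Measurable fun ω : ℕ → Visit S A => ω n := measurable_pi_apply n
  exact h (MeasurableSet.of_discrete (s := {v}))

variable [Fintype S] [Fintype A]

/-- The probability that the process is in `v` at time `n`. -/
def marginal (m : SSP S A) (π : Policy S A) (s : S) (n : ℕ) (v : Visit S A) : ℝ≥0∞ :=
  episodeLaw m π s {ω | ω n = v}

lemma map_eval_zero_episodeLaw (m : SSP S A) (π : Policy S A) (s : S) :
    (episodeLaw m π s).map (fun ω => ω 0) = (act π s).toMeasure := by
  have h : (fun ω : ℕ → Visit S A => ω 0) =
      (MeasurableEquiv.piUnique (fun _ : Finset.Iic 0 => Visit S A)) ∘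
        (Preorder.frestrictLe (π := fun _ => Visit S A) 0) := by
    ext ω; rfl
  rw [h, ← Measure.map_map (by fun_prop) (by fun_prop), episodeLaw, Kernel.trajMeasure,
    Measure.map_comp _ _ (by fun_prop), Kernel.traj_map_frestrictLe, Kernel.partialTraj_self,
    Measure.id_comp, Measure.map_map (by fun_prop) (by fun_prop)]
  exact Measure.map_id

lemma marginal_zero (m : SSP S A) (π : Policy S A) (s : S) (v : Visit S A) :
    marginal m π s 0 v = act π s v := by
  have := congrArg (fun μ => μ {v}) (map_eval_zero_episodeLaw m π s)
  beta_reduce at this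
  rw [Measure.map_apply (by fun_prop) .of_discrete, PMF.toMeasure_apply_singleton _ _ .of_discrete]
    at this
  exact this

/-- The trajectory measure disintegrates along the history up to time `n`. The kernel sees only the
last coordinate of the history, so it is constant on the event and the integral factors. -/
lemma episodeLaw_eval_succ (m : SSP S A) (π : Policy S A) (s : S) (n : ℕ) (u v : Visit S A) :
    episodeLaw m π s {ω | ω n = u ∧ ω (n + 1) = v} = marginal m π s n u * step m π u v := by
  have h := Kernel.map_frestrictLe_trajMeasure_compProd_eq_map_trajMeasure
    (X := fun _ => Visit S A) (μ₀ := (act π s).toMeasure) (κ := historyKernel m π) (a := n)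
  have hU : MeasurableSet {h : (i : Finset.Iic n) → Visit S A |
      h ⟨n, Finset.mem_Iic.2 le_rfl⟩ = u} := by
    have h : Measurable fun h : (i : Finset.Iic n) → Visit S A =>
      h ⟨n, Finset.mem_Iic.2 le_rfl⟩ := measurable_pi_apply _
    exact h (MeasurableSet.of_discrete (s := {u}))
  have := congrArg (fun μ => μ ({h : (i : Finset.Iic n) → Visit S A |
      h ⟨n, Finset.mem_Iic.2 le_rfl⟩ = u} ×ˢ {v})) h
  beta_reduce at this
  rw [Measure.map_apply (by fun_prop) (hU.prod .of_discrete),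
    Measure.compProd_apply_prod hU .of_discrete] at this
  have e : ∀ x ∈ {h : (i : Finset.Iic n) → Visit S A | h ⟨n, Finset.mem_Iic.2 le_rfl⟩ = u},
      historyKernel m π n x {v} = step m π u v := by
    intro x hx
    simp only [Set.mem_ofPred_eq] at hx
    simp only [historyKernel, Kernel.comap_apply, stepKernel, Kernel.ofFunOfCountable,
      Kernel.coe_mk, hx]
    exact PMF.toMeasure_apply_singleton _ _ .of_discrete
  rw [setLIntegral_congr_fun hU e, setLIntegral_const, Measure.map_apply (by fun_prop) hU] at this
  rw [mul_comm]
  exact this.symm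

lemma marginal_succ (m : SSP S A) (π : Policy S A) (s : S) (n : ℕ) (v : Visit S A) :
    marginal m π s (n + 1) v = ∑ u, marginal m π s n u * step m π u v := by
  simp_rw [← episodeLaw_eval_succ]
  rw [← measure_biUnion_finset]
  · unfold marginal; congr 1; ext ω; simp
  · intro u _ u' _ hne
    refine Set.disjoint_left.2 fun ω h1 h2 => hne (h1.1.symm.trans h2.1)
  · intro u _
    exact (measurableSet_eval_eq n u).inter (measurableSet_eval_eq (n + 1) v)

end Marginals

/-! ### Visits, survival probabilities and hitting times -/

section Visits

variable {S A : Type*}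

open Classical in
lemma act_apply_some (π : Policy S A) (s s' : S) (a : A) :
    act π s (some (s', a)) = if s' = s then π s a else 0 := by
  unfold act
  rw [PMF.map_apply]
  split_ifs with h
  · subst h
    rw [tsum_eq_single a]
    · simp
    · intro b hb
      simp [hb.symm]
  · simp [h]

lemma step_none_some (m : SSP S A) (π : Policy S A) (x : S × A) :
    step m π none (some x) = 0 := by
  simp [step]

lemma step_some_some [Fintype S] (m : SSP S A) (π : Policy S A) (x : S × A) (s' : S) (a : A) :
    step m π (some x) (some (s', a)) = m.P x.1 x.2 (some s') * π s' a := by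
  classical
  obtain ⟨s, b⟩ := x
  simp only [step, PMF.bind_apply]
  rw [tsum_eq_single (some s')]
  · simp [enter, act_apply_some]
  · rintro (_ | s'') h
    · simp [enter]
    · have : s' ≠ s'' := fun h' => h (by rw [h'])
      simp [enter, act_apply_some, this]

lemma sum_policy [Fintype A] (π : Policy S A) (s : S) : ∑ a, π s a = 1 := by
  rw [← tsum_fintype (L := .unconditional _)]; exact (π s).tsum_coe

/-- Indicator of not being in the goal. -/
def aliveInd : Visit S A → ℝ≥0∞
  | none => 0
  | some _ => 1

lemma aliveInd_of_ne {v : Visit S A} (h : v ≠ none) : aliveInd v = 1 := by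
  cases v with
  | none => exact absurd rfl h
  | some _ => rfl

/-- This half holds for every trajectory: each time before the first visit to the goal contributes
1. The reverse inequality needs absorption, hence holds only almost surely. -/
lemma hitTime_le (ω : ℕ → Visit S A) : hitTime ω ≤ ∑' n, aliveInd (ω n) := by
  classical
  by_cases h : ∃ n, ω n = none
  · calc hitTime ω ≤ (Nat.find h : ℝ≥0∞) := iInf₂_le (Nat.find h) (Nat.find_spec h)
      _ = ∑ n ∈ Finset.range (Nat.find h), aliveInd (ω n) := by
        rw [Finset.sum_congr rfl fun n hn =>
          aliveInd_of_ne (Nat.find_min h (Finset.mem_range.1 hn))]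
        simp
      _ ≤ _ := ENNReal.sum_le_tsum _
  · push Not at h
    simp [aliveInd_of_ne (h _)]

lemma tsum_aliveInd_le {ω : ℕ → Visit S A} (hω : ∀ n, ω n = none → ω (n + 1) = none) :
    ∑' n, aliveInd (ω n) ≤ hitTime ω := by
  refine le_iInf₂ fun n hn => ?_
  have h : ∀ k ≥ n, ω k = none := fun k hk => Nat.le_induction hn (fun k _ => hω k) k hk
  rw [tsum_eq_sum (s := Finset.range n)]
  · calc ∑ k ∈ Finset.range n, aliveInd (ω k) ≤ ∑ k ∈ Finset.range n, 1 := by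
          refine Finset.sum_le_sum fun k _ => ?_
          cases ω k <;> simp [aliveInd]
      _ = n := by simp
  · intro k hk
    rw [h k (by simpa using hk)]; rfl

variable [Fintype S] [Fintype A]

lemma lintegral_eval (m : SSP S A) (π : Policy S A) (s : S) (n : ℕ) (f : Visit S A → ℝ≥0∞) :
    ∫⁻ ω, f (ω n) ∂(episodeLaw m π s) = ∑ v, f v * marginal m π s n v := by
  have h : Measurable fun ω : ℕ → Visit S A => ω n := measurable_pi_apply n
  rw [← lintegral_map (f := f) .of_discrete h, lintegral_fintype]
  refine Finset.sum_congr rfl fun v _ => ?_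
  rw [Measure.map_apply h .of_discrete]
  rfl

/-- The expected number of visits to `x`. -/
def visits (m : SSP S A) (π : Policy S A) (s : S) (x : S × A) : ℝ≥0∞ :=
  ∑' n, marginal m π s n (some x)

/-- The probability that the goal has not been reached at time `n`. -/
def alive (m : SSP S A) (π : Policy S A) (s : S) (n : ℕ) : ℝ≥0∞ :=
  ∑ x, marginal m π s n (some x)

/-- The expected number of visits to non-goal states. -/
def lifetime (m : SSP S A) (π : Policy S A) (s : S) : ℝ≥0∞ := ∑ x, visits m π s x

lemma lifetime_eq_tsum (m : SSP S A) (π : Policy S A) (s : S) :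
    lifetime m π s = ∑' n, alive m π s n := by
  unfold lifetime visits alive
  exact (Summable.tsum_finsetSum fun _ _ => ENNReal.summable).symm

lemma visits_le_lifetime (m : SSP S A) (π : Policy S A) (s : S) (x : S × A) :
    visits m π s x ≤ lifetime m π s :=
  Finset.single_le_sum (f := visits m π s) (fun _ _ => zero_le) (Finset.mem_univ x)

open Classical in
lemma marginal_zero_some (m : SSP S A) (π : Policy S A) (s s' : S) (a : A) :
    marginal m π s 0 (some (s', a)) = if s' = s then π s a else 0 := by
  rw [marginal_zero, act_apply_some]

lemma marginal_succ_some (m : SSP S A) (π : Policy S A) (s : S) (n : ℕ) (s' : S) (a : A) :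
    marginal m π s (n + 1) (some (s', a)) =
      (∑ x : S × A, marginal m π s n (some x) * m.P x.1 x.2 (some s')) * π s' a := by
  rw [marginal_succ, Fintype.sum_option, step_none_some, mul_zero, zero_add, Finset.sum_mul]
  exact Finset.sum_congr rfl fun x _ => by rw [step_some_some, mul_assoc]

lemma alive_zero (m : SSP S A) (π : Policy S A) (s : S) : alive m π s 0 = 1 := by
  classical
  simp [alive, Fintype.sum_prod_type, marginal_zero_some, sum_policy]

lemma costToGo_eq_sum_visits (m : SSP S A) (c : S × A → ℝ) (π : Policy S A) (s : S) :
    costToGo m c π s = ∑ x, ENNReal.ofReal (c x) * visits m π s x := by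
  unfold costToGo episodeCost
  rw [lintegral_tsum]
  · simp_rw [lintegral_eval, Fintype.sum_option]
    simp only [visitCost, zero_mul, zero_add]
    rw [Summable.tsum_finsetSum fun _ _ => ENNReal.summable]
    exact Finset.sum_congr rfl fun x _ => ENNReal.tsum_mul_left
  · intro n
    have h : Measurable fun ω : ℕ → Visit S A => ω n := measurable_pi_apply n
    exact ((Measurable.of_discrete (f := visitCost c)).comp h).aemeasurable

lemma occupancy_eq_visits (m : SSP S A) (π : Policy S A) (x : S × A) :
    occupancy m π x = (visits m π m.s₀ x).toReal := by
  unfold occupancy visits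
  rw [lintegral_tsum]
  · congr 2
    ext n
    exact lintegral_indicator_one (measurableSet_eval_eq n (some x))
  · intro n
    exact ((measurable_indicator_const_iff (1 : ℝ≥0∞)).2
      (measurableSet_eval_eq n (some x))).aemeasurable

lemma costToGo_le_lifetime (m : SSP S A) {c : S × A → ℝ} (hc : ∀ x, c x ≤ 1) (π : Policy S A)
    (s : S) : costToGo m c π s ≤ lifetime m π s := by
  rw [costToGo_eq_sum_visits]
  refine Finset.sum_le_sum fun x _ => ?_
  exact mul_le_of_le_one_left' (by simpa using hc x)

lemma lintegral_tsum_aliveInd (m : SSP S A) (π : Policy S A) (s : S) :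
    ∫⁻ ω, ∑' n, aliveInd (ω n) ∂(episodeLaw m π s) = lifetime m π s := by
  rw [lintegral_tsum, lifetime_eq_tsum]
  · congr 1; ext n
    rw [lintegral_eval, Fintype.sum_option]
    simp [aliveInd, alive]
  · intro n
    have h : Measurable fun ω : ℕ → Visit S A => ω n := measurable_pi_apply n
    exact ((Measurable.of_discrete (f := aliveInd)).comp h).aemeasurable

lemma ae_absorbing (m : SSP S A) (π : Policy S A) (s : S) :
    ∀ᵐ ω ∂(episodeLaw m π s), ∀ n, ω n = none → ω (n + 1) = none := by
  rw [ae_all_iff]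
  intro n
  have : ∀ᵐ ω ∂(episodeLaw m π s), ∀ x : S × A, ¬ (ω n = none ∧ ω (n + 1) = some x) := by
    rw [ae_all_iff]
    intro x
    rw [ae_iff]
    simp only [not_not]
    rw [episodeLaw_eval_succ, step_none_some, mul_zero]
  filter_upwards [this] with ω hω h
  cases h' : ω (n + 1) with
  | none => rfl
  | some x => exact absurd ⟨h, h'⟩ (hω x)

lemma expectedHitTime_eq (m : SSP S A) (π : Policy S A) (s : S) :
    expectedHitTime m π s = lifetime m π s := by
  rw [← lintegral_tsum_aliveInd]
  refine lintegral_congr_ae ?_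
  filter_upwards [ae_absorbing m π s] with ω hω
  exact le_antisymm (hitTime_le ω) (tsum_aliveInd_le hω)

/-- Chapman–Kolmogorov, split just after the transition that follows time `n`: the rest of the chain
then starts afresh in a state, its action not yet drawn. This explains the shift `n + 1 + N`. -/
lemma marginal_add (m : SSP S A) (π : Policy S A) (s : S) (n N : ℕ) (y : S × A) :
    marginal m π s (n + 1 + N) (some y) = ∑ x : S × A, marginal m π s n (some x) *
      ∑ s', m.P x.1 x.2 (some s') * marginal m π s' N (some y) := by
  classical
  induction N generalizing y with
  | zero =>
    obtain ⟨s', a⟩ := y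
    rw [add_zero, marginal_succ_some, Finset.sum_mul]
    refine Finset.sum_congr rfl fun x _ => ?_
    simp [marginal_zero_some, mul_assoc]
  | succ N ih =>
    obtain ⟨s', a⟩ := y
    rw [← add_assoc, marginal_succ_some]
    simp_rw [marginal_succ_some, ih, Finset.sum_mul, Finset.mul_sum, Finset.sum_mul]
    rw [Finset.sum_comm]
    refine Finset.sum_congr rfl fun x _ => ?_
    rw [Finset.sum_comm]
    refine Finset.sum_congr rfl fun s'' _ => Finset.sum_congr rfl fun z _ => ?_
    ring

lemma alive_add (m : SSP S A) (π : Policy S A) (s : S) (n N : ℕ) :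
    alive m π s (n + 1 + N) = ∑ x : S × A, marginal m π s n (some x) *
      ∑ s', m.P x.1 x.2 (some s') * alive m π s' N := by
  unfold alive
  simp_rw [marginal_add, Finset.mul_sum]
  rw [Finset.sum_comm]
  refine Finset.sum_congr rfl fun x _ => ?_
  rw [Finset.sum_comm]

lemma sum_some_le_one (μ : PMF (Option S)) : ∑ s, μ (some s) ≤ 1 := by
  have : ∑ o, μ o = 1 := by
    rw [← tsum_fintype (L := .unconditional _)]; exact μ.tsum_coe
  rw [Fintype.sum_option] at this
  rw [← this]; exact le_add_self

lemma alive_eq_measure (m : SSP S A) (π : Policy S A) (s : S) (n : ℕ) :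
    alive m π s n = episodeLaw m π s {ω | ω n ≠ none} := by
  classical
  unfold alive marginal
  rw [← measure_biUnion_finset]
  · congr 1; ext ω; simp [Option.ne_none_iff_exists']
  · intro u _ u' _ hne
    refine Set.disjoint_left.2 fun ω h1 h2 => hne ?_
    exact Option.some.inj (h1.symm.trans h2)
  · exact fun u _ => measurableSet_eval_eq n _

lemma alive_le_one (m : SSP S A) (π : Policy S A) (s : S) (n : ℕ) : alive m π s n ≤ 1 := by
  rw [alive_eq_measure]; exact prob_le_one

lemma alive_add_le (m : SSP S A) (π : Policy S A) {N : ℕ} {r : ℝ≥0∞}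
    (h : ∀ s, alive m π s N ≤ r) (s : S) (n : ℕ) :
    alive m π s (n + (1 + N)) ≤ r * alive m π s n := by
  rw [← add_assoc, alive_add, mul_comm]
  unfold alive
  rw [Finset.sum_mul]
  gcongr with x
  calc _ ≤ ∑ s', m.P x.1 x.2 (some s') * r := by gcongr; exact h _
    _ = (∑ s', m.P x.1 x.2 (some s')) * r := by rw [Finset.sum_mul]
    _ ≤ r := mul_le_of_le_one_left' (sum_some_le_one _)

/-- Survival at least halves every `1 + N` steps, so a partial sum `X` satisfies `X ≤ (1 + N) + X /
2`. -/
lemma lifetime_lt_top_of_alive_le (m : SSP S A) (π : Policy S A) {N : ℕ}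
    (h : ∀ s, alive m π s N ≤ 2⁻¹) (s : S) : lifetime m π s < ⊤ := by
  rw [lifetime_eq_tsum]
  have key : ∀ n, ∑ k ∈ Finset.range n, alive m π s k ≤ 2 * (1 + N : ℕ) := by
    intro n
    have h1 : ∑ k ∈ Finset.range n, alive m π s k ≤
        (1 + N : ℕ) + 2⁻¹ * ∑ k ∈ Finset.range n, alive m π s k := by
      calc _ ≤ ∑ k ∈ Finset.range ((1 + N) + n), alive m π s k :=
            Finset.sum_le_sum_of_subset (Finset.range_mono (by omega))
        _ = ∑ k ∈ Finset.range (1 + N), alive m π s k +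
            ∑ k ∈ Finset.range n, alive m π s (k + (1 + N)) := by
            rw [Finset.sum_range_add]; simp_rw [add_comm (1 + N)]
        _ ≤ ∑ k ∈ Finset.range (1 + N), 1 +
            ∑ k ∈ Finset.range n, 2⁻¹ * alive m π s k := by
            gcongr
            · exact alive_le_one _ _ _ _
            · exact alive_add_le m π h s _
        _ = _ := by simp [Finset.mul_sum]
    -- Finiteness of the partial sum is what permits subtracting half of it from both sides.
    have hfin : ∑ k ∈ Finset.range n, alive m π s k ≠ ⊤ :=
      (ENNReal.sum_lt_top.2 fun k _ => (alive_le_one m π s k).trans_lt ENNReal.one_lt_top).ne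
    generalize ∑ k ∈ Finset.range n, alive m π s k = X at h1 hfin
    lift X to NNReal using hfin
    have h2 : (X : ℝ≥0∞) = 2 * (2⁻¹ * X) := by
      rw [← mul_assoc, ENNReal.mul_inv_cancel (by norm_num) (by norm_num), one_mul]
    have e : (2⁻¹ : ℝ≥0∞) = ((2⁻¹ : NNReal) : ℝ≥0∞) := by
      rw [ENNReal.coe_inv (by norm_num)]; rfl
    rw [e] at h1
    norm_cast at h1 ⊢
    have h3 : (X : ℝ) ≤ (1 + N : ℕ) + 2⁻¹ * X := by exact_mod_cast h1
    rw [← NNReal.coe_le_coe]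
    push_cast at h3 ⊢
    linarith
  refine lt_of_le_of_lt (ENNReal.tsum_le_of_sum_range_le key) ?_
  exact ENNReal.mul_lt_top (by norm_num) (ENNReal.natCast_lt_top _)

/-- Continuity from above, applied to the decreasing events of avoiding the goal up to time `n`. By
absorption, being outside the goal at time `n` almost surely implies having avoided it throughout.
-/
lemma IsProper.tendsto_alive {m : SSP S A} {π : Policy S A} (h : IsProper m π) (s : S) :
    Filter.Tendsto (alive m π s) Filter.atTop (nhds 0) := by
  have hm : ∀ n, MeasurableSet {ω : ℕ → Visit S A | ∀ i ≤ n, ω i ≠ none} := by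
    intro n
    have : {ω : ℕ → Visit S A | ∀ i ≤ n, ω i ≠ none} =
        ⋂ i, ⋂ (_ : i ≤ n), {ω | ω i = none}ᶜ := by ext; simp
    rw [this]
    exact .iInter fun i => .iInter fun _ => (measurableSet_eval_eq i none).compl
  have ht := tendsto_measure_iInter_atTop (μ := episodeLaw m π s)
    (fun n => (hm n).nullMeasurableSet)
    (fun a b hab ω hω i hi => hω i (hi.trans hab)) ⟨0, measure_ne_top _ _⟩
  have h0 : episodeLaw m π s (⋂ n, {ω : ℕ → Visit S A | ∀ i ≤ n, ω i ≠ none}) = 0 := by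
    rw [← compl_compl (⋂ n, _)]
    refine (ae_iff (p := fun ω => ω ∈ (⋂ n, {ω : ℕ → Visit S A | ∀ i ≤ n, ω i ≠ none})ᶜ)).1 ?_
    filter_upwards [h s] with ω ⟨n, hn⟩ hω
    exact Set.mem_iInter.1 hω n n le_rfl hn
  rw [h0] at ht
  refine tendsto_of_tendsto_of_tendsto_of_le_of_le tendsto_const_nhds ht
    (fun _ => zero_le) fun n => ?_
  rw [alive_eq_measure]
  refine measure_mono_ae ?_
  filter_upwards [ae_absorbing m π s] with ω hω hn i hi hin
  exact hn (Nat.le_induction hin (fun k _ => hω k) n hi)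

lemma IsProper.lifetime_lt_top {m : SSP S A} {π : Policy S A} (h : IsProper m π) (s : S) :
    lifetime m π s < ⊤ := by
  -- Finiteness of `S` gives one horizon that serves all starting states.
  have : ∀ᶠ n in Filter.atTop, ∀ s, alive m π s n ≤ 2⁻¹ := by
    rw [Filter.eventually_all]
    intro s
    exact (h.tendsto_alive s).eventually_le_const (by simp)
  obtain ⟨N, hN⟩ := this.exists
  exact lifetime_lt_top_of_alive_le m π hN s

end Visits

/-! ### Occupancy measures, the flow polytope and the diameter -/

section Occupancy

variable {S A : Type*}

lemma measurable_episodeCost (c : S × A → ℝ) :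
    Measurable (episodeCost c : (ℕ → Visit S A) → ℝ≥0∞) := by
  refine Measurable.tsum fun n => ?_
  have h : Measurable fun ω : ℕ → Visit S A => ω n := measurable_pi_apply n
  exact (Measurable.of_discrete (f := visitCost c)).comp h

variable [Fintype S] [Fintype A]

-- The flow equation, obtained by summing the one-step recursion over time. In extended nonnegative
-- reals it needs no finiteness.
open Classical in
lemma visits_eq (m : SSP S A) (π : Policy S A) (s s' : S) (a : A) :
    visits m π s (s', a) = ((if s' = s then 1 else 0) +
      ∑ x : S × A, visits m π s x * m.P x.1 x.2 (some s')) * π s' a := by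
  unfold visits
  rw [tsum_eq_zero_add' ENNReal.summable, marginal_zero_some]
  simp_rw [marginal_succ_some]
  rw [ENNReal.tsum_mul_right, Summable.tsum_finsetSum fun _ _ => ENNReal.summable]
  simp_rw [ENNReal.tsum_mul_right]
  rw [add_mul]
  congr 1
  split_ifs with h
  · rw [h, one_mul]
  · rw [zero_mul]

open Classical in
lemma sum_visits_eq (m : SSP S A) (π : Policy S A) (s s' : S) :
    ∑ a, visits m π s (s', a) = (if s' = s then 1 else 0) +
      ∑ x : S × A, visits m π s x * m.P x.1 x.2 (some s') := by
  simp_rw [visits_eq m π s s']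
  rw [← Finset.mul_sum, sum_policy, mul_one]

lemma visits_ne_top {m : SSP S A} {π : Policy S A} {s : S} (h : lifetime m π s < ⊤) (x : S × A) :
    visits m π s x ≠ ⊤ :=
  ((visits_le_lifetime m π s x).trans_lt h).ne

lemma sum_occupancy {m : SSP S A} {π : Policy S A} (h : lifetime m π m.s₀ < ⊤) :
    ∑ x, occupancy m π x = (lifetime m π m.s₀).toReal := by
  simp_rw [occupancy_eq_visits]
  exact (ENNReal.toReal_sum fun x _ => visits_ne_top h x).symm

lemma sum_occupancy_mul {m : SSP S A} {π : Policy S A} (h : lifetime m π m.s₀ < ⊤)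
    {c : S × A → ℝ} (hc : ∀ x, 0 ≤ c x) :
    ∑ x, occupancy m π x * c x = (costToGo m c π m.s₀).toReal := by
  simp_rw [occupancy_eq_visits, costToGo_eq_sum_visits]
  rw [ENNReal.toReal_sum fun x _ => ENNReal.mul_ne_top ENNReal.ofReal_ne_top (visits_ne_top h x)]
  refine Finset.sum_congr rfl fun x _ => ?_
  rw [ENNReal.toReal_mul, ENNReal.toReal_ofReal (hc x), mul_comm]

lemma occupancy_nonneg (m : SSP S A) (π : Policy S A) (x : S × A) : 0 ≤ occupancy m π x :=
  ENNReal.toReal_nonneg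

lemma occupancy_mem_polytope {m : SSP S A} {π : Policy S A} {T : ℝ} (h : lifetime m π m.s₀ < ⊤)
    (hT : (lifetime m π m.s₀).toReal ≤ T) : occupancy m π ∈ polytope m T := by
  classical
  refine ⟨occupancy_nonneg m π, (sum_occupancy h).trans_le hT, fun s => ?_⟩
  have := congrArg ENNReal.toReal (sum_visits_eq m π m.s₀ s)
  have hP : ∀ x : S × A, visits m π m.s₀ x * m.P x.1 x.2 (some s) ≠ ⊤ := fun x =>
    ENNReal.mul_ne_top (visits_ne_top h x) (PMF.apply_ne_top _ _)
  rw [ENNReal.toReal_sum fun a _ => visits_ne_top h _, ENNReal.toReal_add (by split_ifs <;> simp)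
    (ENNReal.sum_ne_top.2 fun x _ => hP x), ENNReal.toReal_sum fun x _ => hP x] at this
  simp_rw [occupancy_eq_visits]
  rw [this]
  simp_rw [ENNReal.toReal_mul, mul_comm]
  split_ifs <;> simp

/-- The visits of an induced policy are dominated by any point of the polytope inducing it. -/
lemma visits_le_of_mem_polytope {m : SSP S A} {T : ℝ} {q : S × A → ℝ} (hq : q ∈ polytope m T)
    {π : Policy S A} (hπ : IsInducedPolicy q π) (x : S × A) :
    visits m π m.s₀ x ≤ ENNReal.ofReal (q x) := by
  classical
  obtain ⟨hq0, -, hflow⟩ := hq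
  have hflow' : ∀ s, (if s = m.s₀ then 1 else 0) +
      ∑ x : S × A, ENNReal.ofReal (q x) * m.P x.1 x.2 (some s) =
        ENNReal.ofReal (∑ a, q (s, a)) := by
    intro s
    have e : ∑ a, q (s, a) = (if s = m.s₀ then 1 else 0) +
        ∑ x : S × A, (m.P x.1 x.2 (some s)).toReal * q x := by
      rw [← hflow s]; ring
    rw [e, ENNReal.ofReal_add (by split_ifs <;> simp) (Finset.sum_nonneg fun x _ =>
      mul_nonneg ENNReal.toReal_nonneg (hq0 x)), ENNReal.ofReal_sum_of_nonneg fun x _ =>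
      mul_nonneg ENNReal.toReal_nonneg (hq0 x)]
    congr 1
    · split_ifs <;> simp
    · refine Finset.sum_congr rfl fun x _ => ?_
      rw [ENNReal.ofReal_mul ENNReal.toReal_nonneg, ENNReal.ofReal_toReal (PMF.apply_ne_top _ _),
        mul_comm]
  have hind : ∀ s a, ENNReal.ofReal (∑ a, q (s, a)) * π s a ≤ ENNReal.ofReal (q (s, a)) := by
    intro s a
    by_cases h0 : ∑ a', q (s, a') = 0
    -- The policy is arbitrary here, but it is multiplied by zero mass.
    · simp [h0]
    · rw [← ENNReal.ofReal_toReal (PMF.apply_ne_top (π s) a), hπ s h0 a,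
        ← ENNReal.ofReal_mul (Finset.sum_nonneg fun a _ => hq0 _), mul_div_cancel₀ _ h0]
  -- The visits are the least nonnegative solution of the flow equation, so partial sums stay below
  -- `q` by induction. Equality is not claimed: `q` may also carry circulations unreachable from
  -- `s₀`.
  have key : ∀ n x, ∑ k ∈ Finset.range n, marginal m π m.s₀ k (some x) ≤ ENNReal.ofReal (q x) := by
    intro n
    induction n with
    | zero => simp
    | succ n ih =>
      rintro ⟨s, a⟩
      refine le_trans ?_ (hind s a)
      rw [Finset.sum_range_succ', ← hflow' s, marginal_zero_some, add_comm]
      simp_rw [marginal_succ_some]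
      rw [← Finset.sum_mul, Finset.sum_comm, add_mul]
      gcongr with x
      · split_ifs with h
        · rw [h, one_mul]
        · simp
      · rw [← Finset.sum_mul]
        gcongr
        exact ih x
  exact ENNReal.tsum_le_of_sum_range_le fun n => key n x

lemma lifetime_lt_top_of_mem_polytope {m : SSP S A} {T : ℝ} {q : S × A → ℝ}
    (hq : q ∈ polytope m T) {π : Policy S A} (hπ : IsInducedPolicy q π) :
    lifetime m π m.s₀ < ⊤ :=
  ENNReal.sum_lt_top.2 fun x _ =>
    (visits_le_of_mem_polytope hq hπ x).trans_lt ENNReal.ofReal_lt_top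

lemma costToGo_toReal_le_of_mem_polytope {m : SSP S A} {T : ℝ} {q : S × A → ℝ}
    (hq : q ∈ polytope m T) {π : Policy S A} (hπ : IsInducedPolicy q π) {c : S × A → ℝ}
    (hc : ∀ x, 0 ≤ c x) : (costToGo m c π m.s₀).toReal ≤ ∑ x, q x * c x := by
  rw [← sum_occupancy_mul (lifetime_lt_top_of_mem_polytope hq hπ) hc]
  refine Finset.sum_le_sum fun x _ => mul_le_mul_of_nonneg_right ?_ (hc x)
  rw [occupancy_eq_visits]
  exact ENNReal.toReal_le_of_le_ofReal (hq.1 x) (visits_le_of_mem_polytope hq hπ x)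

lemma one_le_lifetime (m : SSP S A) (π : Policy S A) (s : S) : 1 ≤ lifetime m π s := by
  rw [lifetime_eq_tsum, ← alive_zero m π s]
  exact ENNReal.le_tsum 0

/-- The diameter as an extended nonnegative real. -/
def ediameter (m : SSP S A) : ℝ≥0∞ :=
  ⨅ (π : Policy S A) (_ : IsProper m π), ⨆ s, expectedHitTime m π s

lemma ediameter_lt_top {m : SSP S A} {π : Policy S A} (h : IsProper m π) : ediameter m < ⊤ := by
  have : Nonempty S := ⟨m.s₀⟩
  refine (iInf₂_le π h).trans_lt ?_
  obtain ⟨s, hs⟩ := exists_eq_ciSup_of_finite (f := fun s => expectedHitTime m π s)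
  rw [← hs, expectedHitTime_eq]
  exact h.lifetime_lt_top s

lemma one_le_ediameter (m : SSP S A) : 1 ≤ ediameter m := by
  refine le_iInf₂ fun π _ => ?_
  refine (one_le_lifetime m π m.s₀).trans ?_
  rw [← expectedHitTime_eq]
  exact le_iSup (fun s => expectedHitTime m π s) m.s₀

lemma one_le_diameter {m : SSP S A} {π : Policy S A} (h : IsProper m π) : 1 ≤ diameter m :=
  (ENNReal.ofReal_le_iff_le_toReal (ediameter_lt_top h).ne).1 (by simpa using one_le_ediameter m)

/-- Since the diameter is finite and at least 1, doubling it leaves strict room above the infimum;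
attainment is not needed. -/
lemma exists_lifetime_le {m : SSP S A} {π : Policy S A} (h : IsProper m π) :
    ∃ π', IsProper m π' ∧ (lifetime m π' m.s₀).toReal ≤ 2 * diameter m := by
  have hlt : ediameter m < 2 * ediameter m := by
    have h1 := one_le_ediameter m
    have h2 := (ediameter_lt_top h).ne
    rw [two_mul]
    exact ENNReal.lt_add_right h2 (by positivity)
  obtain ⟨π', hπ'⟩ := iInf_lt_iff.1 hlt
  obtain ⟨hp, hlt'⟩ := iInf_lt_iff.1 hπ'
  refine ⟨π', hp, ?_⟩
  have hle : lifetime m π' m.s₀ ≤ 2 * ediameter m := by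
    rw [← expectedHitTime_eq]
    exact (le_iSup (fun s => expectedHitTime m π' s) m.s₀).trans hlt'.le
  have := ENNReal.toReal_mono (ENNReal.mul_ne_top (by simp) (ediameter_lt_top h).ne) hle
  rwa [ENNReal.toReal_mul, ENNReal.toReal_ofNat] at this

/-- Every proper policy pays at most its lifetime in each episode. Optimality of `πs` allows
comparison with all of them, then passage to the infimum. -/
lemma sum_costToGo_le {m : SSP S A} {c : ℕ → S × A → ℝ} {K : ℕ} {πs : Policy S A}
    (hc : ∀ k < K, ∀ x, c k x ≤ 1) (h : IsBestInHindsight m c K πs) :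
    ∑ k ∈ Finset.range K, (costToGo m (c k) πs m.s₀).toReal ≤ K * diameter m := by
  have hlt := ediameter_lt_top h.1
  have hle : ∀ π : Policy S A, ∀ k ∈ Finset.range K,
      costToGo m (c k) π m.s₀ ≤ lifetime m π m.s₀ := fun π k hk =>
    costToGo_le_lifetime m (hc k (Finset.mem_range.1 hk)) π m.s₀
  rw [← ENNReal.toReal_sum fun k hk => ((hle πs k hk).trans_lt (h.1.lifetime_lt_top _)).ne]
  have key : ∑ k ∈ Finset.range K, costToGo m (c k) πs m.s₀ ≤ K * ediameter m := by
    -- A factor moves through the infima only if nonzero: for improper `π` the inner infimum is `⊤`,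
    -- and `0 * ⊤ = 0`.
    rcases Nat.eq_zero_or_pos K with rfl | hK
    · simp
    have hK' : (K : ℝ≥0∞) ≠ 0 := by exact_mod_cast hK.ne'
    unfold ediameter
    rw [ENNReal.mul_iInf_of_ne hK' (by simp)]
    refine le_iInf fun π => ?_
    rw [ENNReal.mul_iInf_of_ne hK' (by simp)]
    refine le_iInf fun hπ => (h.2 π hπ).trans ((Finset.sum_le_sum (hle π)).trans ?_)
    rw [Finset.sum_const, Finset.card_range, nsmul_eq_mul, ← expectedHitTime_eq]
    gcongr
    exact le_iSup (fun s => expectedHitTime m π s) m.s₀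
  have := ENNReal.toReal_mono (ENNReal.mul_ne_top (by simp) hlt.ne) key
  rwa [ENNReal.toReal_mul, ENNReal.toReal_natCast] at this

lemma integrable_episodeCost {m : SSP S A} {c : S × A → ℝ} {π : Policy S A} {s : S}
    (h : costToGo m c π s ≠ ⊤) :
    Integrable (fun ω => (episodeCost c ω).toReal) (episodeLaw m π s) :=
  integrable_toReal_of_lintegral_ne_top (measurable_episodeCost c).aemeasurable h

lemma integral_episodeCost {m : SSP S A} {c : S × A → ℝ} {π : Policy S A} {s : S}
    (h : costToGo m c π s ≠ ⊤) :
    ∫ ω, (episodeCost c ω).toReal ∂(episodeLaw m π s) = (costToGo m c π s).toReal :=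
  integral_toReal (measurable_episodeCost c).aemeasurable
    (ae_lt_top (measurable_episodeCost c) h)

instance (m : SSP S A) (K : ℕ) (π : ℕ → Policy S A) :
    IsProbabilityMeasure (learnerLaw m K π) := by
  unfold learnerLaw; infer_instance

lemma integrable_regret {m : SSP S A} {c : ℕ → S × A → ℝ} {K : ℕ} {π : ℕ → Policy S A}
    (h : ∀ k < K, costToGo m (c k) (π k) m.s₀ ≠ ⊤) (πs : Policy S A) :
    Integrable (regret m c K πs) (learnerLaw m K π) := by
  refine (integrable_finsetSum _ fun k _ => ?_).sub (integrable_const _)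
  exact integrable_comp_eval (μ := fun k : Fin K => episodeLaw m (π k) m.s₀) (i := k)
    (integrable_episodeCost (h k k.2))

lemma integral_regret {m : SSP S A} {c : ℕ → S × A → ℝ} {K : ℕ} {π : ℕ → Policy S A}
    (h : ∀ k < K, costToGo m (c k) (π k) m.s₀ ≠ ⊤) (πs : Policy S A) :
    ∫ ω, regret m c K πs ω ∂(learnerLaw m K π) =
      ∑ k ∈ Finset.range K, (costToGo m (c k) (π k) m.s₀).toReal -
        ∑ k ∈ Finset.range K, (costToGo m (c k) πs m.s₀).toReal := by
  have hi : ∀ k : Fin K, Integrable (fun ω : Fin K → ℕ → Visit S A =>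
      (episodeCost (c k) (ω k)).toReal) (learnerLaw m K π) := fun k =>
    integrable_comp_eval (μ := fun k : Fin K => episodeLaw m (π k) m.s₀) (i := k)
      (integrable_episodeCost (h k k.2))
  unfold regret
  rw [integral_sub (integrable_finsetSum _ fun k _ => hi k) (integrable_const _),
    integral_finsetSum _ fun k _ => hi k, integral_const, probReal_univ, one_smul,
    Finset.sum_range fun k => (costToGo m (c k) (π k) m.s₀).toReal,
    Finset.sum_range fun k => (costToGo m (c k) πs m.s₀).toReal]
  congr 1
  refine Finset.sum_congr rfl fun k _ => ?_
  rw [← integral_episodeCost (h k k.2)]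
  exact integral_comp_eval (μ := fun k : Fin K => episodeLaw m (π k) m.s₀) (i := k)
    (integrable_episodeCost (h k k.2)).aestronglyMeasurable

end Occupancy

/-! ### Mirror descent: the three-point inequality and coordinatewise gains -/

section MirrorDescentInequality

section Convex

variable {E : Type*} [NormedAddCommGroup E] [NormedSpace ℝ E]

lemma fderiv_nonneg_of_isMinOn {Q : Set E} (hQ : Convex ℝ Q) {F : E → ℝ} {F' : E →L[ℝ] ℝ}
    {x u : E} (hx : x ∈ Q) (hu : u ∈ Q) (hF : HasFDerivAt F F' x) (hmin : IsMinOn F Q x) :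
    0 ≤ F' (u - x) :=
  hmin.localize.hasFDerivWithinAt_nonneg hF.hasFDerivWithinAt
    (sub_mem_posTangentConeAt_of_segment_subset (hQ.segment_subset hx hu))

end Convex

section MirrorDescent

variable {Γ : Type*} [Fintype Γ]

lemma bregman_le_sub_of_isMinOn {Q : Set (Γ → ℝ)} (hQ : Convex ℝ Q) {ψ : (Γ → ℝ) → ℝ}
    {x u : Γ → ℝ} (hx : x ∈ Q) (hu : u ∈ Q) (hψ : DifferentiableAt ℝ ψ x)
    (hmin : IsMinOn ψ Q x) : bregman ψ u x ≤ ψ u - ψ x := by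
  have := fderiv_nonneg_of_isMinOn hQ hx hu hψ.hasFDerivAt hmin
  unfold bregman
  linarith

/-- The three-point inequality for a mirror descent step. -/
lemma add_bregman_le_of_isMinOn {Q : Set (Γ → ℝ)} (hQ : Convex ℝ Q) {ψ : (Γ → ℝ) → ℝ}
    {η : ℝ} {c x y u : Γ → ℝ} (hx : x ∈ Q) (hu : u ∈ Q) (hψ : DifferentiableAt ℝ ψ x)
    (hmin : IsMinOn (fun z => η * ∑ i, z i * c i + bregman ψ z y) Q x) :
    (η * ∑ i, x i * c i + bregman ψ x y) + bregman ψ u x ≤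
      η * ∑ i, u i * c i + bregman ψ u y := by
  let ℓ : (Γ → ℝ) →L[ℝ] ℝ := ∑ i, c i • ContinuousLinearMap.proj i
  have hℓ : ∀ z, ℓ z = ∑ i, z i * c i := fun z => by
    simp [ℓ, mul_comm]
  have hF : HasFDerivAt (fun z => η * ∑ i, z i * c i + bregman ψ z y)
      (η • ℓ + (fderiv ℝ ψ x - fderiv ℝ ψ y)) x := by
    simp_rw [← hℓ]
    refine (ℓ.hasFDerivAt.const_mul η).add ?_
    unfold bregman
    refine (hψ.hasFDerivAt.sub_const _).sub ?_
    exact (fderiv ℝ ψ y).hasFDerivAt.comp x ((hasFDerivAt_id x).sub_const y)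
  -- First-order optimality in the direction `u - x`. Expanding the three Bregman terms turns it
  -- into the claim.
  have h := fderiv_nonneg_of_isMinOn hQ hx hu hF hmin
  simp only [add_apply, smul_apply,
    sub_apply, smul_eq_mul, map_sub, hℓ] at h
  unfold bregman
  simp only [map_sub]
  linarith

/-- Because the exponent exceeds 1, differentiability holds also where coordinates vanish, so the
boundary of the orthant needs no separate treatment. -/
lemma hasFDerivAt_regularizer {p : ℝ} (hp : 0 < p) (y : Γ → ℝ) :
    HasFDerivAt (regularizer p) (∑ i, (p * ((1 + 1 / p) * |y i| ^ (1 + 1 / p - 2) * y i)) •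
      (ContinuousLinearMap.proj i : (Γ → ℝ) →L[ℝ] ℝ)) y := by
  have h1 : (1 : ℝ) < 1 + 1 / p := by simp [hp]
  unfold regularizer
  simp_rw [← smul_smul p]
  rw [← Finset.smul_sum]
  refine HasFDerivAt.const_mul ?_ p
  refine HasFDerivAt.const_add _ ?_
  refine HasFDerivAt.fun_sum fun i _ => ?_
  exact (hasDerivAt_abs_rpow (y i) h1).comp_hasFDerivAt y
    (ContinuousLinearMap.proj (R := ℝ) (φ := fun _ : Γ => ℝ) i).hasFDerivAt

lemma differentiable_regularizer {p : ℝ} (hp : 0 < p) :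
    Differentiable ℝ (regularizer p : (Γ → ℝ) → ℝ) :=
  fun y => (hasFDerivAt_regularizer hp y).differentiableAt

lemma deriv_abs_rpow_of_nonneg {p y : ℝ} (hp : 0 < p) (hy : 0 ≤ y) :
    p * ((1 + 1 / p) * |y| ^ (1 + 1 / p - 2) * y) = (p + 1) * y ^ (1 / p) := by
  rcases hy.eq_or_lt with rfl | hy
  · simp [Real.zero_rpow (inv_ne_zero hp.ne')]
  · have e : y ^ (1 / p) = y ^ (1 + 1 / p - 2) * y := by
      rw [← Real.rpow_add_one hy.ne']; congr 1; ring
    rw [abs_of_pos hy, e]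
    generalize y ^ (1 + 1 / p - 2) = z
    field_simp

lemma rpow_one_add_inv {p x : ℝ} (hp : 0 < p) (hx : 0 ≤ x) :
    x ^ (1 + 1 / p) = x * x ^ (1 / p) := by
  rw [Real.rpow_add_of_nonneg hx zero_le_one (by positivity), Real.rpow_one]

lemma bregman_regularizer {p : ℝ} (hp : 0 < p) {x y : Γ → ℝ} (hx : ∀ i, 0 ≤ x i)
    (hy : ∀ i, 0 ≤ y i) : bregman (regularizer p) x y =
      ∑ i, (p * x i ^ (1 + 1 / p) + y i ^ (1 + 1 / p) - (p + 1) * y i ^ (1 / p) * x i) := by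
  unfold bregman
  rw [(hasFDerivAt_regularizer hp y).fderiv]
  simp only [sum_apply, smul_apply,
    ContinuousLinearMap.proj_apply, smul_eq_mul, Pi.sub_apply,
    deriv_abs_rpow_of_nonneg hp (hy _)]
  simp only [regularizer, abs_of_nonneg (hx _), abs_of_nonneg (hy _)]
  rw [Finset.sum_sub_distrib, Finset.sum_add_distrib, ← Finset.mul_sum]
  have e : ∀ i, (p + 1) * y i ^ (1 / p) * (x i - y i) =
      (p + 1) * y i ^ (1 / p) * x i - (p + 1) * y i ^ (1 + 1 / p) := fun i => by
    rw [rpow_one_add_inv hp (hy i)]; ring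
  simp_rw [e]
  rw [Finset.sum_sub_distrib, ← Finset.mul_sum]
  ring

/-- A lower bound for the unconstrained minimum of one coordinate of a mirror descent step. -/
def stepGain (p t q : ℝ) : ℝ := q * q ^ (1 / p) * (1 - Real.exp (-(t / q ^ (1 / p))))

lemma stepGain_nonneg {p t q : ℝ} (ht : 0 ≤ t) (hq : 0 ≤ q) : 0 ≤ stepGain p t q := by
  unfold stepGain
  have h1 : 0 ≤ q ^ (1 / p) := by positivity
  have : Real.exp (-(t / q ^ (1 / p))) ≤ 1 := Real.exp_le_one_iff.2 (by simp; positivity)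
  exact mul_nonneg (by positivity) (by linarith)

/-- With `y = q ^ (1 / p)`, minimizing over `x ≥ 0` is Young's inequality for the exponents `p + 1`
and `1 + 1 / p`. The optimal slope `y - t / (p + 1)` is replaced by the larger `w = y * exp (-t /
((p + 1) * y))`, whose power `w ^ (p + 1)` is exactly `y ^ (p + 1) * exp (-t / y)`. -/
lemma stepGain_le {p t q x : ℝ} (hp : 0 < p) (ht : 0 ≤ t) (hq : 0 ≤ q) (hx : 0 ≤ x) :
    stepGain p t q ≤
      t * x + (p * x ^ (1 + 1 / p) + q ^ (1 + 1 / p) - (p + 1) * q ^ (1 / p) * x) := by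
  unfold stepGain
  rw [← rpow_one_add_inv hp hq]
  set y := q ^ (1 / p) with hy
  have hy0 : 0 ≤ y := by positivity
  rcases hy0.eq_or_lt with h0 | hpos
  -- For `y = 0` the convention `t / 0 = 0` makes the gain zero.
  · rw [← h0]; simp; positivity
  have hqy : q ^ (1 + 1 / p) = y ^ (p + 1) := by
    rw [hy, ← Real.rpow_mul hq]; congr 1; field_simp
  set w := y * Real.exp (-(t / ((p + 1) * y))) with hw
  have hw1 : (p + 1) * y - t ≤ (p + 1) * w := by
    have h := Real.add_one_le_exp (-(t / ((p + 1) * y)))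
    have h2 : (p + 1) * y * (-(t / ((p + 1) * y)) + 1) = (p + 1) * y - t := by
      field_simp; ring
    rw [← h2, hw, ← mul_assoc]
    gcongr
  have hw2 : w ^ (p + 1) = y ^ (p + 1) * Real.exp (-(t / y)) := by
    rw [hw, Real.mul_rpow hy0 (Real.exp_pos _).le, ← Real.exp_mul]
    congr 2; field_simp
  have hyoung := Real.young_inequality_of_nonneg (a := w) (b := x) (p := p + 1)
    (q := 1 + 1 / p) (by positivity) hx
    (Real.holderConjugate_iff.2 ⟨by linarith, by field_simp; ring⟩)
  have hY : (p + 1) * (w * x) ≤ w ^ (p + 1) + p * x ^ (1 + 1 / p) := by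
    calc _ ≤ (p + 1) * (w ^ (p + 1) / (p + 1) + x ^ (1 + 1 / p) / (1 + 1 / p)) := by gcongr
      _ = _ := by field_simp
  rw [hw2] at hY
  rw [hqy]
  nlinarith [mul_le_mul_of_nonneg_right hw1 hx]

lemma neg_le_regularizer {p : ℝ} (hp : 0 < p) (q : Γ → ℝ) : -p ≤ regularizer p q := by
  unfold regularizer
  have : 0 ≤ ∑ x, |q x| ^ (1 + 1 / p) := Finset.sum_nonneg fun i _ => by positivity
  nlinarith

lemma regularizer_le {p T : ℝ} (hp : 0 < p) {u : Γ → ℝ} (hu : ∀ i, 0 ≤ u i)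
    (hT : ∑ i, u i ≤ T) : regularizer p u ≤ p * (-1 + T * T ^ (1 / p)) := by
  unfold regularizer
  have hle : ∀ i, u i ≤ T := fun i =>
    (Finset.single_le_sum (fun j _ => hu j) (Finset.mem_univ i)).trans hT
  have hT0 : 0 ≤ T := (Finset.sum_nonneg fun i _ => hu i).trans hT
  have : ∑ x, |u x| ^ (1 + 1 / p) ≤ T * T ^ (1 / p) := by
    calc _ ≤ ∑ x, u x * T ^ (1 / p) := by
          gcongr with i
          rw [abs_of_nonneg (hu i), rpow_one_add_inv hp (hu i)]
          gcongr
          · exact hu i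
          · exact hu i
          · exact hle i
      _ = (∑ x, u x) * T ^ (1 / p) := by rw [Finset.sum_mul]
      _ ≤ _ := by gcongr
  gcongr

/-- The mirror descent inequality. -/
lemma IsOMD.sum_stepGain_le {Q : Set (Γ → ℝ)} (hQ : Convex ℝ Q) (hQ0 : ∀ x ∈ Q, ∀ i, 0 ≤ x i)
    {p η : ℝ} (hp : 0 < p) (hη : 0 ≤ η) {c : ℕ → Γ → ℝ} {K : ℕ} (hK : 0 < K)
    (hc : ∀ k < K, ∀ i, 0 ≤ c k i) {q : ℕ → Γ → ℝ} (h : IsOMD Q (regularizer p) η c K q)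
    {u : Γ → ℝ} (hu : u ∈ Q) {T : ℝ} (hT : ∑ i, u i ≤ T) :
    ∑ k ∈ Finset.range K, ∑ i, stepGain p (η * c k i) (q k i) ≤
      η * ∑ k ∈ Finset.range K, ∑ i, u i * c k i + p * (T * T ^ (1 / p)) := by
  have hmem : ∀ k < K, q k ∈ Q := by
    rintro (_ | k) hk
    · exact h.1.1
    · exact (h.2 k hk).1
  have hd := differentiable_regularizer (Γ := Γ) hp
  have hlow : ∀ k < K, ∀ x ∈ Q, ∑ i, stepGain p (η * c k i) (q k i) ≤
      η * ∑ i, x i * c k i + bregman (regularizer p) x (q k) := by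
    intro k hk x hx
    rw [bregman_regularizer hp (hQ0 x hx) (hQ0 _ (hmem k hk)), Finset.mul_sum,
      ← Finset.sum_add_distrib]
    refine Finset.sum_le_sum fun i _ => ?_
    refine (stepGain_le hp (mul_nonneg hη (hc k hk i)) (hQ0 _ (hmem k hk) i)
      (hQ0 x hx i)).trans (le_of_eq ?_)
    ring
  have key : ∀ n < K, ∑ k ∈ Finset.range n, ∑ i, stepGain p (η * c k i) (q k i) +
      bregman (regularizer p) u (q n) ≤
        η * ∑ k ∈ Finset.range n, ∑ i, u i * c k i + bregman (regularizer p) u (q 0) := by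
    intro n hn
    induction n with
    | zero => simp
    | succ n ih =>
      have h1 := ih (by omega)
      obtain ⟨hq, hmin⟩ := h.2 n hn
      have h2 := add_bregman_le_of_isMinOn hQ hq hu (hd _) hmin
      have h3 := hlow n (by omega) _ hq
      rw [Finset.sum_range_succ, Finset.sum_range_succ, mul_add]
      linarith
  obtain ⟨n, rfl⟩ := Nat.exists_eq_succ_of_ne_zero hK.ne'
  have h1 := key n (Nat.lt_succ_self n)
  -- The last round has no successor iterate, so its gain is bounded at `u` itself, using up the
  -- leftover divergence `bregman u (q n)`.
  have h2 := hlow n (Nat.lt_succ_self n) u hu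
  have h3 := bregman_le_sub_of_isMinOn hQ h.1.1 hu (hd _) h.1.2
  have h4 := neg_le_regularizer hp (q 0)
  have h5 := regularizer_le hp (hQ0 u hu) hT
  rw [Finset.sum_range_succ, Finset.sum_range_succ, mul_add]
  linarith

lemma sub_sq_div_two_le_one_sub_exp_neg {t : ℝ} (ht : 0 ≤ t) :
    t - t ^ 2 / 2 ≤ 1 - Real.exp (-t) := by
  have h := Real.quadratic_le_exp_of_nonneg ht
  have h2 : Real.exp (-t) * Real.exp t = 1 := by rw [← Real.exp_add]; simp
  have h3 : 0 < Real.exp (-t) := Real.exp_pos _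
  have h4 : 0 ≤ 1 - t + t ^ 2 / 2 := by nlinarith [sq_nonneg (t - 1)]
  have h5 : Real.exp (-t) * (1 + t + t ^ 2 / 2) ≤ 1 :=
    (mul_le_mul_of_nonneg_left h h3.le).trans_eq h2
  by_contra hcon
  push Not at hcon
  have h6 : 1 - t + t ^ 2 / 2 < Real.exp (-t) := by linarith
  -- `(1 - t + t ^ 2 / 2) * (1 + t + t ^ 2 / 2) = 1 + t ^ 4 / 4`, which is at least 1.
  nlinarith [mul_lt_mul_of_pos_right h6 (show 0 < 1 + t + t ^ 2 / 2 by positivity),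
    sq_nonneg (t ^ 2)]

lemma min_one_div_two_le_one_sub_exp_neg {t : ℝ} (ht : 0 ≤ t) :
    min 1 t / 2 ≤ 1 - Real.exp (-t) := by
  rcases le_total t 1 with h | h
  · rw [min_eq_right h]
    nlinarith [sub_sq_div_two_le_one_sub_exp_neg ht]
  · rw [min_eq_left h]
    have h1 : Real.exp (-t) ≤ Real.exp (-1) := Real.exp_le_exp.2 (by linarith)
    have h2 := sub_sq_div_two_le_one_sub_exp_neg (zero_le_one (α := ℝ))
    linarith

/-- Second-order expansion of the exponential. The error involves `q ^ (1 - 1 / p)`: for `q ≥ 1 / M`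
it is at most `M ^ (1 / p) * q`, otherwise monotonicity bounds it by its value at `1 / M`. The terms
`c / M` will sum to at most 1. -/
lemma le_stepGain_of_small {p M η c q : ℝ} (hp : 1 < p) (hM : 0 < M) (hη : 0 ≤ η)
    (hc : 0 ≤ c) (hc1 : c ≤ 1) (hq : 0 ≤ q) :
    η * (q * c - η * M ^ (1 / p) / 2 * (q * c + c / M)) ≤ stepGain p (η * c) q := by
  have hp0 : 0 < p := by linarith
  have hμ : 0 < M ^ (1 / p) := by positivity
  have hμM : (M ^ (1 / p)) ^ p = M := by
    rw [← Real.rpow_mul hM.le, one_div_mul_cancel hp0.ne', Real.rpow_one]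
  rcases hq.eq_or_lt with rfl | hq
  · simp only [stepGain, zero_mul, zero_sub, zero_add]
    have : 0 ≤ η * (η * M ^ (1 / p) / 2 * (c / M)) := by positivity
    linarith
  unfold stepGain
  set μ := M ^ (1 / p)
  have hqy : (q ^ (1 / p)) ^ p = q := by
    rw [← Real.rpow_mul hq.le, one_div_mul_cancel hp0.ne', Real.rpow_one]
  set y := q ^ (1 / p)
  have hy : 0 < y := by positivity
  have h1 := sub_sq_div_two_le_one_sub_exp_neg (t := η * c / y) (by positivity)
  have h2 : q / y ≤ μ * q + μ / M := by
    rcases le_total μ⁻¹ y with h | h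
    · have : q / y ≤ μ * q := by
        rw [div_le_iff₀ hy]
        have : 1 ≤ μ * y := by
          calc 1 = μ * μ⁻¹ := (mul_inv_cancel₀ hμ.ne').symm
            _ ≤ _ := by gcongr
        nlinarith
      have : 0 ≤ μ / M := by positivity
      linarith
    · have e1 : q / y = y ^ (p - 1) := by rw [Real.rpow_sub_one hy.ne', hqy]
      have e2 : μ / M = μ⁻¹ ^ (p - 1) := by
        rw [Real.inv_rpow hμ.le, Real.rpow_sub_one hμ.ne', hμM, inv_div]
      have : y ^ (p - 1) ≤ μ⁻¹ ^ (p - 1) :=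
        Real.rpow_le_rpow hy.le h (by linarith)
      have : 0 ≤ μ * q := by positivity
      linarith
  have hcc : c ^ 2 ≤ c := by nlinarith
  calc η * (q * c - η * μ / 2 * (q * c + c / M))
      = η * q * c - η ^ 2 / 2 * ((μ * q + μ / M) * c) := by ring
    _ ≤ η * q * c - η ^ 2 / 2 * (q / y * c ^ 2) := by gcongr
    _ = q * y * (η * c / y - (η * c / y) ^ 2 / 2) := by field_simp
    _ ≤ _ := by gcongr

/-- Split at `q ^ (1 / p) = c / M ^ (1 / p)`. Above it, `1 - exp (-t) ≥ min 1 t / 2` gives enough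
gain; below it, `q ≤ c ^ p / M ≤ 1 / M`. -/
lemma le_stepGain_of_large {p M η c q : ℝ} (hp : 1 < p) (hM : 0 < M)
    (hη : 1 ≤ η * M ^ (1 / p)) (hc : 0 ≤ c) (hc1 : c ≤ 1) (hq : 0 ≤ q) :
    q * c ≤ 2 * M ^ (1 / p) * stepGain p (η * c) q + c / M := by
  have hp0 : 0 < p := by linarith
  have hμ : 0 < M ^ (1 / p) := by positivity
  have hμM : (M ^ (1 / p)) ^ p = M := by
    rw [← Real.rpow_mul hM.le, one_div_mul_cancel hp0.ne', Real.rpow_one]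
  set μ := M ^ (1 / p)
  have hη0 : 0 < η := pos_of_mul_pos_left (by linarith) hμ.le
  have hG := stepGain_nonneg (p := p) (t := η * c) (by positivity) hq
  rcases hc.eq_or_lt with rfl | hcpos
  · simp only [mul_zero, zero_div, add_zero] at hG ⊢
    positivity
  have hqy : (q ^ (1 / p)) ^ p = q := by
    rw [← Real.rpow_mul hq, one_div_mul_cancel hp0.ne', Real.rpow_one]
  rcases le_total (c / μ) (q ^ (1 / p)) with h | h
  · have hy : 0 < q ^ (1 / p) := lt_of_lt_of_le (by positivity) h
    have h1 := min_one_div_two_le_one_sub_exp_neg (t := η * c / q ^ (1 / p)) (by positivity)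
    have h2 : q * c ≤ 2 * μ * stepGain p (η * c) q := by
      unfold stepGain
      set y := q ^ (1 / p)
      have hmin : c / μ ≤ y * min 1 (η * c / y) := by
        rw [mul_min_of_nonneg _ _ hy.le]
        refine le_min (by linarith) ?_
        rw [mul_div_cancel₀ _ hy.ne', div_le_iff₀ hμ]
        nlinarith
      calc q * c = μ * q * (c / μ) := by field_simp
        _ ≤ μ * q * (y * min 1 (η * c / y)) := by gcongr
        _ = 2 * μ * (q * y * (min 1 (η * c / y) / 2)) := by ring
        _ ≤ _ := by gcongr
    have : 0 ≤ c / M := by positivity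
    linarith
  · have h1 : q ≤ (c / μ) ^ p := by
      rw [← hqy]; exact Real.rpow_le_rpow (by positivity) h hp0.le
    rw [Real.div_rpow hc hμ.le, hμM] at h1
    have h2 : c ^ p ≤ 1 := Real.rpow_le_one hc hc1 hp0.le
    have h3 : q * c ≤ c / M := by
      calc q * c ≤ (c ^ p / M) * c := by gcongr
        _ ≤ (1 / M) * c := by gcongr
        _ = c / M := by ring
    have : 0 ≤ 2 * μ * stepGain p (η * c) q := by positivity
    linarith

end MirrorDescent

end MirrorDescentInequality

/-! ### Regret of mirror descent over the polytope -/

section Regret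

section MirrorDescent

variable {Γ : Type*} [Fintype Γ]

lemma sum_div_le_one {c : Γ → ℝ} {M : ℝ} (hM : 0 < M) (h : ∑ i, c i ≤ M) :
    ∑ i, c i / M ≤ 1 := by
  rw [← Finset.sum_div]; exact (div_le_one hM).2 h

/-- Regret of mirror descent when the step size is small relative to the sparsity. -/
lemma IsOMD.regret_le_of_small_step {Q : Set (Γ → ℝ)} (hQ : Convex ℝ Q)
    (hQ0 : ∀ x ∈ Q, ∀ i, 0 ≤ x i) {p η : ℝ} (hp : 1 < p) (hη : 0 < η) {c : ℕ → Γ → ℝ} {K : ℕ}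
    (hK : 0 < K) (hc : ∀ k < K, ∀ i, 0 ≤ c k i ∧ c k i ≤ 1) {M : ℝ} (hM : 0 < M)
    (hcM : ∀ k < K, ∑ i, c k i ≤ M) {q : ℕ → Γ → ℝ} (h : IsOMD Q (regularizer p) η c K q)
    (hq : ∀ k < K, q k ∈ Q) {u : Γ → ℝ} (hu : u ∈ Q) {T : ℝ} (hT : ∑ i, u i ≤ T)
    (ha : η * M ^ (1 / p) ≤ 1) {D : ℝ} (hD : 1 ≤ D)
    (huD : ∑ k ∈ Finset.range K, ∑ i, u i * c k i ≤ K * D)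
    (hηD : η ^ 2 * (K * D * M ^ (1 / p)) = p * (T * T ^ (1 / p))) :
    ∑ k ∈ Finset.range K, ∑ i, q k i * c k i - ∑ k ∈ Finset.range K, ∑ i, u i * c k i ≤
      4 * (η * M ^ (1 / p) * K * D) := by
  have hgain := h.sum_stepGain_le hQ hQ0 (by linarith) hη.le hK (fun k hk i => (hc k hk i).1) hu hT
  have hlow : ∀ k ∈ Finset.range K,
      η * (∑ i, q k i * c k i - η * M ^ (1 / p) / 2 * (∑ i, q k i * c k i + 1)) ≤
        ∑ i, stepGain p (η * c k i) (q k i) := by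
    intro k hk
    have hk := Finset.mem_range.1 hk
    calc _ ≤ η * (∑ i, q k i * c k i - η * M ^ (1 / p) / 2 *
          (∑ i, q k i * c k i + ∑ i, c k i / M)) := by
          gcongr; exact sum_div_le_one hM (hcM k hk)
      _ = ∑ i, η * (q k i * c k i - η * M ^ (1 / p) / 2 * (q k i * c k i + c k i / M)) := by
          rw [← Finset.mul_sum, Finset.sum_sub_distrib, ← Finset.mul_sum, Finset.sum_add_distrib]
      _ ≤ _ := Finset.sum_le_sum fun i _ => le_stepGain_of_small hp hM hη.le (hc k hk i).1
          (hc k hk i).2 (hQ0 _ (hq k hk) i)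
  have hsum := (Finset.sum_le_sum hlow).trans hgain
  rw [← Finset.mul_sum, Finset.sum_sub_distrib, ← Finset.mul_sum, Finset.sum_add_distrib,
    Finset.sum_const, Finset.card_range, nsmul_eq_mul, mul_one, ← hηD] at hsum
  set L := ∑ k ∈ Finset.range K, ∑ i, q k i * c k i
  set U := ∑ k ∈ Finset.range K, ∑ i, u i * c k i
  have hμ : 0 < M ^ (1 / p) := by positivity
  set μ := M ^ (1 / p)
  -- By the choice of `η`, the penalty divided by `η` is exactly `η * μ * K * D`.
  have hdiv : L - η * μ / 2 * (L + K) ≤ U + η * μ * K * D := by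
    refine le_of_mul_le_mul_left (hsum.trans (le_of_eq ?_)) hη
    ring
  have hK0 : (0 : ℝ) ≤ K := Nat.cast_nonneg K
  have ha0 : 0 < η * μ := by positivity
  have h1 : η * μ * K ≤ η * μ * K * D := le_mul_of_one_le_right (by positivity) hD
  have h2 : η * μ * U ≤ η * μ * K * D := by
    rw [mul_assoc (η * μ)]; gcongr
  generalize η * μ = a at *
  -- Since `a ≤ 1`, the factor `1 - a / 2` is at least `1 / 2`, whence the constant 4.
  have h3 : (L - U) * (1 - a / 2) ≤ 2 * (a * K * D) := by nlinarith
  by_cases hLU : L - U ≤ 0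
  · have : 0 ≤ a * K * D := by positivity
    linarith
  · push Not at hLU
    nlinarith

/-- Total loss of mirror descent when the step size is large relative to the sparsity. -/
lemma IsOMD.loss_le_of_large_step {Q : Set (Γ → ℝ)} (hQ : Convex ℝ Q)
    (hQ0 : ∀ x ∈ Q, ∀ i, 0 ≤ x i) {p η : ℝ} (hp : 1 < p) (hη : 0 < η) {c : ℕ → Γ → ℝ} {K : ℕ}
    (hK : 0 < K) (hc : ∀ k < K, ∀ i, 0 ≤ c k i ∧ c k i ≤ 1) {M : ℝ} (hM : 0 < M)
    (hcM : ∀ k < K, ∑ i, c k i ≤ M) {q : ℕ → Γ → ℝ} (h : IsOMD Q (regularizer p) η c K q)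
    (hq : ∀ k < K, q k ∈ Q) {u : Γ → ℝ} (hu : u ∈ Q) {T : ℝ} (hT : ∑ i, u i ≤ T)
    (ha : 1 ≤ η * M ^ (1 / p)) :
    ∑ k ∈ Finset.range K, ∑ i, q k i * c k i ≤
      K + 2 * M ^ (1 / p) *
        (η * ∑ k ∈ Finset.range K, ∑ i, u i * c k i + p * (T * T ^ (1 / p))) := by
  have hgain := h.sum_stepGain_le hQ hQ0 (by linarith) hη.le hK (fun k hk i => (hc k hk i).1) hu hT
  calc ∑ k ∈ Finset.range K, ∑ i, q k i * c k i
      ≤ ∑ k ∈ Finset.range K, (2 * M ^ (1 / p) * ∑ i, stepGain p (η * c k i) (q k i) + 1) := by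
        refine Finset.sum_le_sum fun k hk => ?_
        have hk := Finset.mem_range.1 hk
        calc _ ≤ ∑ i, (2 * M ^ (1 / p) * stepGain p (η * c k i) (q k i) + c k i / M) :=
              Finset.sum_le_sum fun i _ => le_stepGain_of_large hp hM ha (hc k hk i).1
                (hc k hk i).2 (hQ0 _ (hq k hk) i)
          _ ≤ _ := by
              rw [Finset.sum_add_distrib, ← Finset.mul_sum]
              gcongr
              exact sum_div_le_one hM (hcM k hk)
    _ = K + 2 * M ^ (1 / p) *
        ∑ k ∈ Finset.range K, ∑ i, stepGain p (η * c k i) (q k i) := by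
        rw [Finset.sum_add_distrib, ← Finset.mul_sum]; simp [add_comm]
    _ ≤ _ := by gcongr

lemma sum_abs_le_of_sparsityLevel {c : ℕ → Γ → ℝ} {K : ℕ}
    (hc : ∀ k < K, ∀ x, 0 ≤ c k x ∧ c k x ≤ 1) {k : ℕ} (hk : k < K) :
    ∑ x, |c k x| ≤ sparsityLevel c K := by
  classical
  have h1 : {x | 0 < c k x}.ncard ≤ sparsityLevel c K :=
    Finset.le_sup (f := fun k => {x | 0 < c k x}.ncard) (Finset.mem_range.2 hk)
  have h2 : ∑ x, |c k x| ≤ ({x | 0 < c k x}.ncard : ℝ) := by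
    have e : {x | 0 < c k x} = ((Finset.univ.filter fun x => 0 < c k x : Finset Γ) : Set Γ) := by
      ext; simp
    rw [e, Set.ncard_coe_finset, Finset.card_filter]
    push_cast
    refine Finset.sum_le_sum fun x _ => ?_
    rw [abs_of_nonneg (hc k hk x).1]
    split_ifs with h
    · simpa using (hc k hk x).2
    · simpa using h
  exact h2.trans (by exact_mod_cast h1)

end MirrorDescent

variable {S A : Type*} [Fintype S] [Fintype A]

lemma convex_polytope (m : SSP S A) (T : ℝ) : Convex ℝ (polytope m T) := by
  rintro x ⟨hx0, hxT, hxf⟩ y ⟨hy0, hyT, hyf⟩ a b ha hb hab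
  refine ⟨fun i => ?_, ?_, fun s => ?_⟩
  · have := hx0 i; have := hy0 i
    simp only [Pi.add_apply, Pi.smul_apply, smul_eq_mul]; positivity
  · simp only [Pi.add_apply, Pi.smul_apply, smul_eq_mul]
    rw [Finset.sum_add_distrib, ← Finset.mul_sum, ← Finset.mul_sum]
    calc _ ≤ a * T + b * T := by gcongr
      _ = T := by rw [← add_mul, hab, one_mul]
  · simp only [Pi.add_apply, Pi.smul_apply, smul_eq_mul, mul_add, Finset.sum_add_distrib,
      mul_left_comm _ a, mul_left_comm _ b, ← Finset.mul_sum]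
    have h1 := hxf s
    have h2 := hyf s
    calc _ = a * (∑ i, x (s, i) - ∑ i : S × A, (m.P i.1 i.2 (some s)).toReal * x i) +
        b * (∑ i, y (s, i) - ∑ i : S × A, (m.P i.1 i.2 (some s)).toReal * y i) := by ring
      _ = _ := by rw [h1, h2, ← add_mul, hab, one_mul]

/-- A comparator in the polytope whose length is of the order of the diameter. -/
lemma exists_short_comparator {m : SSP S A} {c : ℕ → S × A → ℝ} {K : ℕ} {πs : Policy S A} {T : ℝ}
    (hc : ∀ k < K, ∀ x, 0 ≤ c k x ∧ c k x ≤ 1) (hbest : IsBestInHindsight m c K πs)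
    (hT : occupancy m πs ∈ polytope m T) :
    ∃ u ∈ polytope m T, ∃ T' : ℝ, ∑ x, u x ≤ T' ∧ T' ≤ T ∧ T' ≤ 2 * diameter m ∧
      ∑ k ∈ Finset.range K, ∑ x, u x * c k x ≤ 2 * (K * diameter m) := by
  have hD := one_le_diameter hbest.1
  -- If `T` is already short, `πs` itself serves. Otherwise a nearly fastest proper policy fits into
  -- the polytope.
  rcases le_total T (2 * diameter m) with h | h
  · refine ⟨_, hT, T, hT.2.1, le_rfl, h, ?_⟩
    have := sum_costToGo_le (fun k hk x => (hc k hk x).2) hbest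
    rw [Finset.sum_congr rfl fun k hk => sum_occupancy_mul (hbest.1.lifetime_lt_top _)
      fun x => (hc k (Finset.mem_range.1 hk) x).1]
    have : (0 : ℝ) ≤ K * diameter m := by positivity
    linarith
  · obtain ⟨π, hπ, hlen⟩ := exists_lifetime_le hbest.1
    have hlt := hπ.lifetime_lt_top m.s₀
    refine ⟨_, occupancy_mem_polytope hlt (hlen.trans h), _, (sum_occupancy hlt).le,
      hlen.trans h, hlen, ?_⟩
    calc _ ≤ ∑ k ∈ Finset.range K, 2 * diameter m := by
          refine Finset.sum_le_sum fun k hk => ?_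
          refine le_trans ?_ ((sum_occupancy hlt).trans_le hlen)
          exact Finset.sum_le_sum fun x _ => mul_le_of_le_one_right (occupancy_nonneg m π x)
            (hc k (Finset.mem_range.1 hk) x).2
      _ = _ := by simp; ring

/-- Regret of the occupancy measures computed by mirror descent. -/
lemma IsOMD.regret_le {m : SSP S A} {K : ℕ} {c : ℕ → S × A → ℝ} {T M p η : ℝ}
    {πs : Policy S A} {q : ℕ → S × A → ℝ} (hK : 0 < K)
    (hc : ∀ k < K, ∀ x, 0 ≤ c k x ∧ c k x ≤ 1) (hM : 0 < M) (hcM : ∀ k < K, ∑ x, c k x ≤ M)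
    (hT0 : 0 < T) (hbest : IsBestInHindsight m c K πs) (hT : occupancy m πs ∈ polytope m T)
    (hp : 1 < p) (hTM : (T * M) ^ (1 / p) = Real.exp 1)
    (hη : η = √(p * T ^ (1 + 1 / p) / (K * diameter m * M ^ (1 / p))))
    (h : IsOMD (polytope m T) (regularizer p) η c K q) :
    ∑ k ∈ Finset.range K, ∑ x, q k x * c k x -
      ∑ k ∈ Finset.range K, ∑ x, occupancy m πs x * c k x ≤
        22 * √(diameter m * K * T * p) := by
  have hD := one_le_diameter hbest.1
  have hmem : ∀ k < K, q k ∈ polytope m T := by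
    rintro (_ | k) hk
    · exact h.1.1
    · exact (h.2 k hk).1
  have hU : ∑ k ∈ Finset.range K, ∑ x, occupancy m πs x * c k x ≤ K * diameter m := by
    rw [Finset.sum_congr rfl fun k hk => sum_occupancy_mul (hbest.1.lifetime_lt_top _)
      fun x => (hc k (Finset.mem_range.1 hk) x).1]
    exact sum_costToGo_le (fun k hk x => (hc k hk x).2) hbest
  obtain ⟨u, hu, T', huT', hT'T, hT'D, huc⟩ := exists_short_comparator hc hbest hT
  set D := diameter m
  have hK1 : (1 : ℝ) ≤ K := by exact_mod_cast hK
  have hμ : 0 < M ^ (1 / p) := by positivity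
  have hη0 : 0 < η := by rw [hη]; positivity
  have hηD : η ^ 2 * (K * D * M ^ (1 / p)) = p * (T * T ^ (1 / p)) := by
    rw [hη, Real.sq_sqrt (by positivity), rpow_one_add_inv (by linarith) hT0.le]
    field_simp
  rw [Real.mul_rpow hT0.le hM.le] at hTM
  -- The square of the left side is `(T * M) ^ (1 / p) = e` times `D * K * T * p`, and `e ≤ 4`.
  have hX : η * M ^ (1 / p) * K * D ≤ 2 * √(D * K * T * p) := by
    refine le_of_sq_le_sq ?_ (by positivity)
    rw [mul_pow 2, Real.sq_sqrt (by positivity)]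
    calc (η * M ^ (1 / p) * K * D) ^ 2 =
        (η ^ 2 * (K * D * M ^ (1 / p))) * M ^ (1 / p) * K * D := by ring
      _ = (T ^ (1 / p) * M ^ (1 / p)) * (D * K * T * p) := by rw [hηD]; ring
      _ ≤ _ := by
        rw [hTM]; gcongr; linarith [Real.exp_one_lt_three]
  have hY : 0 ≤ √(D * K * T * p) := Real.sqrt_nonneg _
  rcases le_total (η * M ^ (1 / p)) 1 with ha | ha
  · have := h.regret_le_of_small_step (convex_polytope m T) (fun x hx => hx.1) hp hη0 hK hc hM hcM
      hmem hT hT.2.1 ha hD hU hηD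
    linarith
  · have hU0 : 0 ≤ ∑ k ∈ Finset.range K, ∑ x, occupancy m πs x * c k x :=
      Finset.sum_nonneg fun k hk => Finset.sum_nonneg fun x _ =>
        mul_nonneg (occupancy_nonneg m πs x) (hc k (Finset.mem_range.1 hk) x).1
    rcases le_total (T * K) (p * D) with hTK | hTK
    · have h1 : ∑ k ∈ Finset.range K, ∑ x, q k x * c k x ≤ T * K := by
        calc _ ≤ ∑ k ∈ Finset.range K, T := by
              refine Finset.sum_le_sum fun k hk => ?_
              have hk := Finset.mem_range.1 hk
              refine le_trans (Finset.sum_le_sum fun x _ => ?_) (hmem k hk).2.1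
              exact mul_le_of_le_one_right ((hmem k hk).1 x) (hc k hk x).2
          _ = T * K := by simp [mul_comm]
      -- `(T * K) ^ 2 ≤ (T * K) * (p * D)` in this case.
      have h2 : T * K ≤ √(D * K * T * p) := by
        refine Real.le_sqrt_of_sq_le ?_
        nlinarith [mul_le_mul_of_nonneg_left hTK (show 0 ≤ T * K by positivity)]
      linarith
    · have h1 := h.loss_le_of_large_step (convex_polytope m T) (fun x hx => hx.1) hp hη0 hK hc hM
        hcM hmem hu huT' ha
      have hT'0 : 0 ≤ T' := (Finset.sum_nonneg fun x _ => hu.1 x).trans huT'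
      -- One factor `p * D` is exchanged for `T * K`; this needs `T' ≤ 2 * D` and the case
      -- hypothesis.
      have h2 : p * T' ≤ 2 * √(D * K * T * p) := by
        refine le_of_sq_le_sq ?_ (by positivity)
        rw [mul_pow 2, Real.sq_sqrt (by positivity)]
        calc (p * T') ^ 2 = p * T' * (p * T') := by ring
          _ ≤ p * (2 * D) * (p * (2 * D)) := by gcongr
          _ = p * (2 * D) * (2 * (p * D)) := by ring
          _ ≤ p * (2 * D) * (2 * (T * K)) := by gcongr
          _ = _ := by ring
      have h3 : M ^ (1 / p) * (p * (T' * T' ^ (1 / p))) ≤ 3 * (p * T') := by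
        calc _ ≤ M ^ (1 / p) * (p * (T' * T ^ (1 / p))) := by gcongr
          _ = (T ^ (1 / p) * M ^ (1 / p)) * (p * T') := by ring
          _ ≤ _ := by rw [hTM]; gcongr; exact Real.exp_one_lt_three.le
      have h4 : M ^ (1 / p) * (η * ∑ k ∈ Finset.range K, ∑ x, u x * c k x) ≤
          2 * (η * M ^ (1 / p) * K * D) := by
        calc _ ≤ M ^ (1 / p) * (η * (2 * (K * D))) := by gcongr
          _ = _ := by ring
      have h5 : (K : ℝ) ≤ η * M ^ (1 / p) * K * D := by
        rw [mul_assoc]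
        have : (K : ℝ) ≤ K * D := le_mul_of_one_le_right (by positivity) hD
        nlinarith
      -- With `Y = √(D * K * T * p)`, the three terms of `h1` contribute `2 Y`, `8 Y` and `12 Y`:
      -- this is the constant 22.
      linarith

end Regret

end SSP

end

/-! ### From occupancy measures back to the expected regret -/

theorem theorem4p1 :
    ∃ C : ℝ, 0 < C ∧
      ∀ (S A : Type*) [Fintype S] [Fintype A] (m : SSP S A)
        (K : ℕ) (c : ℕ → S × A → ℝ) (T M p η : ℝ)
        (πs : SSP.Policy S A) (q : ℕ → S × A → ℝ) (π : ℕ → SSP.Policy S A),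
        0 < K →
        (∀ k < K, ∀ x, 0 ≤ c k x ∧ c k x ≤ 1) →
        (M = SSP.sparsityLevel c K ∨ ∀ k < K, ∑ x, |c k x| ≤ M) →
        Real.exp 1 < T →
        SSP.IsBestInHindsight m c K πs →
        SSP.occupancy m πs ∈ SSP.polytope m T →
        p = Real.log (T * M) →
        1 < p →
        η = √(p * T ^ (1 + 1 / p) / (K * SSP.diameter m * M ^ (1 / p))) →
        SSP.IsOMD (SSP.polytope m T) (SSP.regularizer p) η c K q →
        (∀ k < K, SSP.IsInducedPolicy (q k) (π k)) →
        (∀ k < K, SSP.expectedHitTime m (π k) m.s₀ < ⊤) ∧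
        MeasureTheory.Integrable (SSP.regret m c K πs) (SSP.learnerLaw m K π) ∧
        ∫ ω, SSP.regret m c K πs ω ∂(SSP.learnerLaw m K π) ≤
          C * √(SSP.diameter m * K * T * Real.log (M * T)) := by

  refine ⟨22, by norm_num, ?_⟩
  intro S A _ _ m K c T M p η πs q π hK hc hM hT hbest hocc hp hp1 hη hOMD hπ
  have hcM : ∀ k < K, ∑ x, |c k x| ≤ M := by
    rcases hM with rfl | hM
    · exact fun k hk => SSP.sum_abs_le_of_sparsityLevel hc hk
    · exact hM
  have hT0 : 0 < T := (Real.exp_pos 1).trans hT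
  have hM0 : 0 < M := by
    have h0 : 0 ≤ M := (Finset.sum_nonneg fun x _ => abs_nonneg _).trans (hcM 0 hK)
    refine h0.lt_of_ne ?_
    rintro rfl
    -- For `M = 0` the convention `log 0 = 0` gives `p = 0`, contradicting `1 < p`.
    rw [mul_zero, Real.log_zero] at hp
    linarith
  have hTM : (T * M) ^ (1 / p) = Real.exp 1 := by
    rw [Real.rpow_def_of_pos (by positivity), ← hp, mul_one_div_cancel (by linarith)]
  have hmem : ∀ k < K, q k ∈ SSP.polytope m T := by
    rintro (_ | k) hk
    · exact hOMD.1.1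
    · exact (hOMD.2 k hk).1
  have hlt : ∀ k < K, SSP.lifetime m (π k) m.s₀ < ⊤ := fun k hk =>
    SSP.lifetime_lt_top_of_mem_polytope (hmem k hk) (hπ k hk)
  have hcost : ∀ k < K, SSP.costToGo m (c k) (π k) m.s₀ ≠ ⊤ := fun k hk =>
    ((SSP.costToGo_le_lifetime m (fun x => (hc k hk x).2) _ _).trans_lt (hlt k hk)).ne
  refine ⟨fun k hk => ?_, SSP.integrable_regret hcost πs, ?_⟩
  · rw [SSP.expectedHitTime_eq]; exact hlt k hk
  rw [SSP.integral_regret hcost πs, mul_comm M T, ← hp]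
  -- The learner's expected cost is at most the linear loss of `q k`, while the comparator's cost
  -- equals its linear loss.
  refine le_trans (sub_le_sub ?_ (le_of_eq ?_)) (SSP.IsOMD.regret_le hK hc hM0
    (fun k hk => (Finset.sum_le_sum fun x _ => le_abs_self _).trans (hcM k hk))
    hT0 hbest hocc hp1 hTM hη hOMD)
  · exact Finset.sum_le_sum fun k hk => SSP.costToGo_toReal_le_of_mem_polytope
      (hmem k (Finset.mem_range.1 hk)) (hπ k (Finset.mem_range.1 hk))
      fun x => (hc k (Finset.mem_range.1 hk) x).1
  · exact Finset.sum_congr rfl fun k hk => SSP.sum_occupancy_mul (hbest.1.lifetime_lt_top _)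
      fun x => (hc k (Finset.mem_range.1 hk) x).1
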